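/- For a set $E$ let $C^\infty(\mathbb R^E)$ be the $C^\infty$-ring of all functions $f:\mathbb R^E\to\mathbb R$ of the form $f=f'\circ\pi$, where $\pi:\mathbb R^E\to\mathbb R^{E'}$ is the restriction to a finite subset $E'\subseteq E$ and $f':\mathbb R^{E'}\to\mathbb R$ is smooth; for $\varphi\in C^\infty(\mathbb R^E)$ put $Z(\varphi)=\{x\in\mathbb R^E : \varphi(x)=0\}$. For an ideal $I$ of a $C^\infty$-ring $A$, its $C^\infty$-radical is $$\sqrt[\infty]{I}=\{a\in A : (A/I)\{(a+I)^{-1}\}\cong 0\},$$ where $B\{b^{-1}\}$ denotes the $C^\infty$-ring of fractions of a $C^\infty$-ring $B$ with respect to $b\in B$ (the universal $C^\infty$-ring under $B$ in which $b$ becomes invertible); $I$ is called $C^\infty$-radical if $\sqrt[\infty]{I}=I$. Proposition. Let $E$ be any set, let $I\subseteq C^\infty(\mathbb R^E)$ be a $C^\infty$-radical ideal, and let $f,g\in C^\infty(\mathbb R^E)$. Then $$f+I=g+I\iff \text{there is } \varphi\in I \text{ such that } f(x)=g(x)\text{ for all }x\in Z(\varphi).$$ Likewise, for every $n\in\mathbb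 N$, every $C^\infty$-radical ideal $I$ of the $C^\infty$-ring $C^\infty(\mathbb R^n)$ of smooth functions on $\mathbb R^n$, and all $f,g\in C^\infty(\mathbb R^n)$, one has $f+I=g+I$ if and only if there is $\varphi\in I$ such that $f(x)=g(x)$ for all $x\in Z(\varphi)$. -/

import Mathlib

universe u v w

namespace SmoothAlgebra

open scoped ContDiff

/-- The `n`-ary function symbols of the theory of `C^∞`-rings: the set `C^∞(ℝⁿ)` of smooth
functions `ℝⁿ → ℝ`. -/
def SmoothMap (n : ℕ) : Type :=
  {f : (Fin n → ℝ) → ℝ // ContDiff ℝ ∞ f}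

namespace SmoothMap

instance (n : ℕ) : CoeFun (SmoothMap n) (fun _ => (Fin n → ℝ) → ℝ) := ⟨Subtype.val⟩

@[ext] theorem ext {n : ℕ} {f g : SmoothMap n} (h : ∀ x, f x = g x) : f = g :=
  Subtype.ext (funext h)

/-- The projection `p_i(x₁, …, xₙ) = x_i`. -/
def proj {n : ℕ} (i : Fin n) : SmoothMap n := ⟨fun x => x i, contDiff_apply ℝ ℝ i⟩

/-- The composite `h ∘ (g₁, …, gₙ)`. -/
def comp {m n : ℕ} (h : SmoothMap n) (g : Fin n → SmoothMap m) : SmoothMap m :=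
  ⟨fun x => h (fun i => g i x), h.2.comp (contDiff_pi.2 fun i => (g i).2)⟩

/-- Constants, as functions of any number of variables. -/
def const (n : ℕ) (c : ℝ) : SmoothMap n := ⟨fun _ => c, contDiff_const⟩

/-- Addition `ℝ² → ℝ`. -/
def add : SmoothMap 2 := ⟨fun x => x 0 + x 1, (contDiff_apply ℝ ℝ 0).add (contDiff_apply ℝ ℝ 1)⟩

/-- Multiplication `ℝ² → ℝ`. -/
def mul : SmoothMap 2 := ⟨fun x => x 0 * x 1, (contDiff_apply ℝ ℝ 0).mul (contDiff_apply ℝ ℝ 1)⟩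

/-- Negation `ℝ → ℝ`. -/
def neg : SmoothMap 1 := ⟨fun x => -x 0, (contDiff_apply ℝ ℝ 0).neg⟩

end SmoothMap

/-- A `C^∞`-ring: a set `A` in which every smooth function `ℝⁿ → ℝ` is interpreted as an `n`-ary
operation, compatibly with projections and with composition. The underlying commutative ring is
recorded as well; it carries no additional information, since its addition and multiplication
are required to be the interpretations of the addition and multiplication of real numbers
(see `CInftyRing.ofOps`, which constructs it from the operations). -/
class CInftyRing (A : Type u) extends CommRing A where
  op : ∀ {n : ℕ}, SmoothMap n → (Fin n → A) → A
  op_proj : ∀ {n : ℕ} (i : Fin n) (a : Fin n → A), op (SmoothMap.proj i) a = a i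
  op_comp : ∀ {m n : ℕ} (h : SmoothMap n) (g : Fin n → SmoothMap m) (a : Fin m → A),
    op (h.comp g) a = op h (fun i => op (g i) a)
  op_add : ∀ a b : A, op SmoothMap.add ![a, b] = a + b
  op_mul : ∀ a b : A, op SmoothMap.mul ![a, b] = a * b

section OfOps

variable {A : Type u} (op : ∀ {n : ℕ}, SmoothMap n → (Fin n → A) → A)

theorem op_two_aux
    (op_comp : ∀ {m n : ℕ} (h : SmoothMap n) (g : Fin n → SmoothMap m) (a : Fin m → A),
      op (h.comp g) a = op h (fun i => op (g i) a))
    {m : ℕ} (h : SmoothMap 2) (p q : SmoothMap m) (a : Fin m → A) :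
    op h ![op p a, op q a] = op (h.comp ![p, q]) a := by
  rw [op_comp]; congr 1; funext i; fin_cases i <;> rfl

theorem op_one_aux
    (op_comp : ∀ {m n : ℕ} (h : SmoothMap n) (g : Fin n → SmoothMap m) (a : Fin m → A),
      op (h.comp g) a = op h (fun i => op (g i) a))
    {m : ℕ} (h : SmoothMap 1) (p : SmoothMap m) (a : Fin m → A) :
    op h ![op p a] = op (h.comp ![p]) a := by
  rw [op_comp]; congr 1; funext i; fin_cases i; rfl

theorem op_const_aux
    (op_comp : ∀ {m n : ℕ} (h : SmoothMap n) (g : Fin n → SmoothMap m) (a : Fin m → A),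
      op (h.comp g) a = op h (fun i => op (g i) a))
    (m : ℕ) (c : ℝ) (a : Fin m → A) :
    op (SmoothMap.const 0 c) ![] = op (SmoothMap.const m c) a := by
  have : SmoothMap.const m c = (SmoothMap.const 0 c).comp (fun i : Fin 0 => i.elim0) := rfl
  rw [this, op_comp]; congr 1; funext i; exact i.elim0

theorem exists_eq_op_proj
    (op_proj : ∀ {n : ℕ} (i : Fin n) (a : Fin n → A), op (SmoothMap.proj i) a = a i) (a b c : A) :
    ∃ t : Fin 3 → A, a = op (SmoothMap.proj 0) t ∧ b = op (SmoothMap.proj 1) t ∧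
      c = op (SmoothMap.proj 2) t :=
  ⟨![a, b, c], (op_proj 0 ![a, b, c]).symm, (op_proj 1 ![a, b, c]).symm,
    (op_proj 2 ![a, b, c]).symm⟩

/-- Operations that are compatible with projections and with composition make a set into a
`C^∞`-ring, with the interpretations of `+`, `·`, `-`, `0`, `1` as its ring structure. -/
@[reducible] def CInftyRing.ofOps
    (op_proj : ∀ {n : ℕ} (i : Fin n) (a : Fin n → A), op (SmoothMap.proj i) a = a i)
    (op_comp : ∀ {m n : ℕ} (h : SmoothMap n) (g : Fin n → SmoothMap m) (a : Fin m → A),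
      op (h.comp g) a = op h (fun i => op (g i) a)) : CInftyRing A where
  add a b := op SmoothMap.add ![a, b]
  mul a b := op SmoothMap.mul ![a, b]
  neg a := op SmoothMap.neg ![a]
  zero := op (SmoothMap.const 0 0) ![]
  one := op (SmoothMap.const 0 1) ![]
  nsmul := @nsmulRec _ ⟨op (SmoothMap.const 0 0) ![]⟩ ⟨fun a b => op SmoothMap.add ![a, b]⟩
  zsmul := @zsmulRec _ ⟨op (SmoothMap.const 0 0) ![]⟩ ⟨fun a b => op SmoothMap.add ![a, b]⟩
    ⟨fun a => op SmoothMap.neg ![a]⟩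
    (@nsmulRec _ ⟨op (SmoothMap.const 0 0) ![]⟩ ⟨fun a b => op SmoothMap.add ![a, b]⟩)
  op := op
  op_proj := op_proj
  op_comp := op_comp
  op_add _ _ := rfl
  op_mul _ _ := rfl
  add_assoc a b c := by
    obtain ⟨t, rfl, rfl, rfl⟩ := exists_eq_op_proj op op_proj a b c
    change op _ ![op _ ![_, _], _] = op _ ![_, op _ ![_, _]]
    simp only [op_two_aux op op_comp]
    congr 1; ext x; exact add_assoc _ _ _
  mul_assoc a b c := by
    obtain ⟨t, rfl, rfl, rfl⟩ := exists_eq_op_proj op op_proj a b c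
    change op _ ![op _ ![_, _], _] = op _ ![_, op _ ![_, _]]
    simp only [op_two_aux op op_comp]
    congr 1; ext x; exact mul_assoc _ _ _
  left_distrib a b c := by
    obtain ⟨t, rfl, rfl, rfl⟩ := exists_eq_op_proj op op_proj a b c
    change op _ ![_, op _ ![_, _]] = op _ ![op _ ![_, _], op _ ![_, _]]
    simp only [op_two_aux op op_comp]
    congr 1; ext x; exact mul_add _ _ _
  right_distrib a b c := by
    obtain ⟨t, rfl, rfl, rfl⟩ := exists_eq_op_proj op op_proj a b c
    change op _ ![op _ ![_, _], _] = op _ ![op _ ![_, _], op _ ![_, _]]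
    simp only [op_two_aux op op_comp]
    congr 1; ext x; exact add_mul _ _ _
  add_comm a b := by
    obtain ⟨t, rfl, rfl, -⟩ := exists_eq_op_proj op op_proj a b a
    change op _ ![_, _] = op _ ![_, _]
    simp only [op_two_aux op op_comp]
    congr 1; ext x; exact add_comm _ _
  mul_comm a b := by
    obtain ⟨t, rfl, rfl, -⟩ := exists_eq_op_proj op op_proj a b a
    change op _ ![_, _] = op _ ![_, _]
    simp only [op_two_aux op op_comp]
    congr 1; ext x; exact mul_comm _ _
  zero_add a := by
    obtain ⟨t, rfl, -, -⟩ := exists_eq_op_proj op op_proj a a a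
    change op _ ![op _ ![], _] = _
    rw [op_const_aux op op_comp 3 0 t]
    simp only [op_two_aux op op_comp]
    congr 1; ext x; exact zero_add _
  add_zero a := by
    obtain ⟨t, rfl, -, -⟩ := exists_eq_op_proj op op_proj a a a
    change op _ ![_, op _ ![]] = _
    rw [op_const_aux op op_comp 3 0 t]
    simp only [op_two_aux op op_comp]
    congr 1; ext x; exact add_zero _
  zero_mul a := by
    obtain ⟨t, rfl, -, -⟩ := exists_eq_op_proj op op_proj a a a
    change op _ ![op _ ![], _] = op _ ![]
    rw [op_const_aux op op_comp 3 0 t]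
    simp only [op_two_aux op op_comp]
    congr 1; ext x; exact zero_mul _
  mul_zero a := by
    obtain ⟨t, rfl, -, -⟩ := exists_eq_op_proj op op_proj a a a
    change op _ ![_, op _ ![]] = op _ ![]
    rw [op_const_aux op op_comp 3 0 t]
    simp only [op_two_aux op op_comp]
    congr 1; ext x; exact mul_zero _
  one_mul a := by
    obtain ⟨t, rfl, -, -⟩ := exists_eq_op_proj op op_proj a a a
    change op _ ![op _ ![], _] = _
    rw [op_const_aux op op_comp 3 1 t]
    simp only [op_two_aux op op_comp]
    congr 1; ext x; exact one_mul _
  mul_one a := by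
    obtain ⟨t, rfl, -, -⟩ := exists_eq_op_proj op op_proj a a a
    change op _ ![_, op _ ![]] = _
    rw [op_const_aux op op_comp 3 1 t]
    simp only [op_two_aux op op_comp]
    congr 1; ext x; exact mul_one _
  neg_add_cancel a := by
    obtain ⟨t, rfl, -, -⟩ := exists_eq_op_proj op op_proj a a a
    change op _ ![op _ ![_], _] = op _ ![]
    rw [op_const_aux op op_comp 3 0 t]
    simp only [op_two_aux op op_comp, op_one_aux op op_comp]
    congr 1; ext x; exact neg_add_cancel _

end OfOps

/-- A homomorphism of `C^∞`-rings: a map that commutes with the interpretations of all smooth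
functions. -/
structure CInftyHom (A : Type u) (B : Type v) [CInftyRing A] [CInftyRing B] where
  toFun : A → B
  map_op : ∀ {n : ℕ} (h : SmoothMap n) (a : Fin n → A),
    toFun (CInftyRing.op h a) = CInftyRing.op h (fun i => toFun (a i))

namespace CInftyHom

variable {A : Type u} {B : Type v} [CInftyRing A] [CInftyRing B]

instance : CoeFun (CInftyHom A B) (fun _ => A → B) := ⟨toFun⟩

theorem map_add (φ : CInftyHom A B) (a b : A) : φ (a + b) = φ a + φ b := by
  rw [← CInftyRing.op_add, φ.map_op, ← CInftyRing.op_add]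
  congr 1; funext i; fin_cases i <;> rfl

theorem map_mul (φ : CInftyHom A B) (a b : A) : φ (a * b) = φ a * φ b := by
  rw [← CInftyRing.op_mul, φ.map_op, ← CInftyRing.op_mul]
  congr 1; funext i; fin_cases i <;> rfl

end CInftyHom

theorem CInftyRing.op_const_zero {A : Type u} [CInftyRing A] (n : ℕ) (a : Fin n → A) :
    CInftyRing.op (SmoothMap.const n 0) a = 0 := by
  have h : (CInftyRing.op (SmoothMap.const n 0) a) + (CInftyRing.op (SmoothMap.const n 0) a) =
      CInftyRing.op (SmoothMap.const n 0) a := by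
    rw [← CInftyRing.op_add, op_two_aux CInftyRing.op CInftyRing.op_comp]
    congr 1; ext x; exact add_zero _
  simpa using h

theorem CInftyRing.op_const_one {A : Type u} [CInftyRing A] (n : ℕ) (a : Fin n → A) :
    CInftyRing.op (SmoothMap.const n 1) a = 1 := by
  have h0 : CInftyRing.op (SmoothMap.const 1 1) ![(1 : A)] = 1 := by
    have h := CInftyRing.op_mul (CInftyRing.op (SmoothMap.const 1 1) ![(1 : A)]) 1
    rw [mul_one] at h
    rw [← h]
    have h1 := CInftyRing.op_proj 0 ![(1 : A)]
    simp only [Matrix.cons_val] at h1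
    nth_rewrite 2 [← h1]
    rw [op_two_aux CInftyRing.op CInftyRing.op_comp]
    refine Eq.trans ?_ h1
    congr 1; ext x; exact one_mul _
  rw [← op_const_aux CInftyRing.op CInftyRing.op_comp n 1 a,
    op_const_aux CInftyRing.op CInftyRing.op_comp 1 1 ![(1 : A)], h0]

/-- The ring homomorphism underlying a homomorphism of `C^∞`-rings. -/
def CInftyHom.toRingHom {A : Type u} {B : Type v} [CInftyRing A] [CInftyRing B]
    (φ : CInftyHom A B) : A →+* B where
  toFun := φ
  map_add' := φ.map_add
  map_mul' := φ.map_mul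
  map_zero' := by
    rw [← CInftyRing.op_const_zero 0 ![], φ.map_op, CInftyRing.op_const_zero]
  map_one' := by
    rw [← CInftyRing.op_const_one 0 ![], φ.map_op, CInftyRing.op_const_one]

/-! ### The `C^∞`-ring `C^∞(ℝⁿ)` -/

/-- `C^∞(ℝⁿ)` as a `C^∞`-ring: operations are given by composition. -/
instance SmoothMap.instCInftyRing (m : ℕ) : CInftyRing (SmoothMap m) :=
  CInftyRing.ofOps (fun h g => h.comp g) (fun _ _ => rfl) (fun _ _ _ => rfl)

namespace SmoothMap

variable {n : ℕ}

@[simp] theorem add_apply (f g : SmoothMap n) (x : Fin n → ℝ) : (f + g) x = f x + g x := rfl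
@[simp] theorem mul_apply (f g : SmoothMap n) (x : Fin n → ℝ) : (f * g) x = f x * g x := rfl
@[simp] theorem neg_apply (f : SmoothMap n) (x : Fin n → ℝ) : (-f) x = -f x := rfl
@[simp] theorem zero_apply (x : Fin n → ℝ) : (0 : SmoothMap n) x = 0 := rfl
@[simp] theorem one_apply (x : Fin n → ℝ) : (1 : SmoothMap n) x = 1 := rfl
@[simp] theorem sub_apply (f g : SmoothMap n) (x : Fin n → ℝ) : (f - g) x = f x - g x := by
  rw [sub_eq_add_neg, add_apply, neg_apply, sub_eq_add_neg]

/-- Evaluation of function symbols at a tuple of elements of a `C^∞`-ring. -/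
def evalHom {A : Type u} [CInftyRing A] (a : Fin n → A) : CInftyHom (SmoothMap n) A where
  toFun f := CInftyRing.op f a
  map_op h g := CInftyRing.op_comp h g a

end SmoothMap

/-! ### The `C^∞`-ring `C^∞(ℝ^E)` for an arbitrary set `E` -/

/-- Smooth functions on `ℝ^E`: those of the form `f' ∘ π` with `π : ℝ^E → ℝ^{E'}` the restriction
to a finite subset `E'` of `E` and `f'` a smooth function on `ℝ^{E'}`. -/
def IsSmoothFun {E : Type u} (f : (E → ℝ) → ℝ) : Prop :=
  ∃ (E' : Finset E) (f' : (E' → ℝ) → ℝ), ContDiff ℝ ∞ f' ∧ f = f' ∘ E'.restrict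

/-- If `E` is finite, then smoothness on `ℝ^E` has its usual meaning. -/
theorem isSmoothFun_iff_contDiff {E : Type u} [Fintype E] (f : (E → ℝ) → ℝ) :
    IsSmoothFun f ↔ ContDiff ℝ ∞ f := by
  constructor
  · rintro ⟨E', f', hf', rfl⟩
    exact hf'.comp (contDiff_pi.2 fun i => contDiff_apply ℝ ℝ (i : E))
  · intro hf
    refine ⟨Finset.univ, fun y => f (fun e => y ⟨e, Finset.mem_univ e⟩), ?_, rfl⟩
    exact hf.comp (contDiff_pi.2 fun i => contDiff_apply ℝ ℝ _)

theorem IsSmoothFun.comp {E : Type u} {n : ℕ} (h : SmoothMap n) (g : Fin n → (E → ℝ) → ℝ)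
    (hg : ∀ i, IsSmoothFun (g i)) : IsSmoothFun (fun x => h (fun i => g i x)) := by
  classical
  choose E' g' hg' hgg using hg
  have hsub : ∀ i, E' i ⊆ Finset.univ.biUnion E' :=
    fun i => Finset.subset_biUnion_of_mem E' (Finset.mem_univ i)
  refine ⟨Finset.univ.biUnion E', 
    fun y => h (fun i => g' i (fun e => y ⟨e, hsub i e.2⟩)), ?_, ?_⟩
  · refine h.2.comp (contDiff_pi.2 fun i => (hg' i).comp (contDiff_pi.2 fun e => ?_))
    exact contDiff_apply ℝ ℝ _
  · funext x
    simp only [hgg]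
    rfl

/-- `C^∞(ℝ^E)`, the set of smooth functions on `ℝ^E`. -/
def SmoothFun (E : Type u) : Type u :=
  {f : (E → ℝ) → ℝ // IsSmoothFun f}

namespace SmoothFun

variable {E : Type u}

instance : CoeFun (SmoothFun E) (fun _ => (E → ℝ) → ℝ) := ⟨Subtype.val⟩

@[ext] theorem ext {f g : SmoothFun E} (h : ∀ x, f x = g x) : f = g :=
  Subtype.ext (funext h)

/-- `C^∞(ℝ^E)` as a `C^∞`-ring: operations are given by composition. -/
instance instCInftyRing : CInftyRing (SmoothFun E) :=
  CInftyRing.ofOps (fun h g => ⟨fun x => h (fun i => g i x), IsSmoothFun.comp h _ fun i => (g i).2⟩)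
    (fun _ _ => rfl) (fun _ _ _ => rfl)

@[simp] theorem op_apply {n : ℕ} (h : SmoothMap n) (g : Fin n → SmoothFun E) (x : E → ℝ) :
    (CInftyRing.op h g : SmoothFun E) x = h (fun i => g i x) := rfl
@[simp] theorem add_apply (f g : SmoothFun E) (x : E → ℝ) : (f + g) x = f x + g x := rfl
@[simp] theorem mul_apply (f g : SmoothFun E) (x : E → ℝ) : (f * g) x = f x * g x := rfl
@[simp] theorem neg_apply (f : SmoothFun E) (x : E → ℝ) : (-f) x = -f x := rfl
@[simp] theorem zero_apply (x : E → ℝ) : (0 : SmoothFun E) x = 0 := rfl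
@[simp] theorem one_apply (x : E → ℝ) : (1 : SmoothFun E) x = 1 := rfl
@[simp] theorem sub_apply (f g : SmoothFun E) (x : E → ℝ) : (f - g) x = f x - g x := by
  rw [sub_eq_add_neg, add_apply, neg_apply, sub_eq_add_neg]

/-- The zeroset `Z(φ) = {x ∈ ℝ^E | φ(x) = 0}`. -/
def zeroSet (φ : SmoothFun E) : Set (E → ℝ) := {x | φ x = 0}

end SmoothFun

/-- The zeroset `Z(φ) = {x ∈ ℝⁿ | φ(x) = 0}`. -/
def SmoothMap.zeroSet {n : ℕ} (φ : SmoothMap n) : Set (Fin n → ℝ) := {x | φ x = 0}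

/-! ### Quotients of `C^∞`-rings by ideals

The operations descend to the quotient by any ring-theoretic ideal, by Hadamard's lemma. -/

theorem contDiff_parametric_integral {X : Type} [NormedAddCommGroup X] [NormedSpace ℝ X]
    [FiniteDimensional ℝ X] (n : ℕ) : ∀ {G : Type} [NormedAddCommGroup G] [NormedSpace ℝ G]
    [CompleteSpace G] (F : X → ℝ → G), ContDiff ℝ n (fun p : X × ℝ => F p.1 p.2) →
    ContDiff ℝ n (fun x => ∫ t in (0 : ℝ)..1, F x t) := by
  induction n with
  | zero =>
    intro G _ _ _ F hF
    rw [Nat.cast_zero, contDiff_zero] at hF ⊢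
    exact intervalIntegral.continuous_parametric_intervalIntegral_of_continuous' hF 0 1
  | succ n ih =>
    intro G _ _ _ F hF
    let F' : X → ℝ → (X →L[ℝ] G) := fun x t =>
      (fderiv ℝ (fun p : X × ℝ => F p.1 p.2) (x, t)).comp (ContinuousLinearMap.inl ℝ X ℝ)
    have hF' : ContDiff ℝ n (fun p : X × ℝ => F' p.1 p.2) := by
      have h := hF.fderiv_right (m := n) (by norm_cast)
      exact h.clm_comp contDiff_const
    have hcont : Continuous (fun p : X × ℝ => F p.1 p.2) := hF.continuous
    have hcont' : Continuous (fun p : X × ℝ => F' p.1 p.2) := hF'.continuous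
    have hder : ∀ x t, HasFDerivAt (fun y => F y t) (F' x t) x := by
      intro x t
      have h1 : HasFDerivAt (fun p : X × ℝ => F p.1 p.2)
          (fderiv ℝ (fun p : X × ℝ => F p.1 p.2) (x, t)) (x, t) :=
        (hF.differentiable (by norm_cast) (x, t)).hasFDerivAt
      have h2 : HasFDerivAt (fun y : X => (y, t)) (ContinuousLinearMap.inl ℝ X ℝ) x :=
        hasFDerivAt_prodMk_left x t
      exact h1.comp x h2
    have key : ∀ x, HasFDerivAt (fun x => ∫ t in (0 : ℝ)..1, F x t)
        (∫ t in (0 : ℝ)..1, F' x t) x := by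
      intro x
      have : ProperSpace X := FiniteDimensional.proper ℝ X
      obtain ⟨C, hC⟩ := ((isCompact_closedBall x 1).prod (isCompact_Icc (a := (0 : ℝ)) (b := 1))
        ).exists_bound_of_continuousOn hcont'.continuousOn
      have hsl : ∀ y, Continuous (F y) :=
        fun y => hcont.comp (by fun_prop : Continuous fun t => (y, t))
      have hsl' : ∀ y, Continuous (F' y) :=
        fun y => hcont'.comp (by fun_prop : Continuous fun t => (y, t))
      refine (intervalIntegral.hasFDerivAt_integral_of_dominated_of_fderiv_le
        (F := F) (F' := F') (x₀ := x) (s := Metric.ball x 1) (bound := fun _ => C)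
        (Metric.ball_mem_nhds x one_pos) ?_ ?_ ?_ ?_ ?_ ?_)
      · exact Filter.Eventually.of_forall fun y => (hsl y).aestronglyMeasurable
      · exact (hsl x).intervalIntegrable 0 1
      · exact (hsl' x).aestronglyMeasurable
      · refine Filter.Eventually.of_forall fun t ht y hy =>
          hC (y, t) ⟨Metric.ball_subset_closedBall hy, ?_⟩
        rw [Set.uIoc_of_le zero_le_one] at ht
        exact ⟨ht.1.le, ht.2⟩
      · exact intervalIntegrable_const
      · exact Filter.Eventually.of_forall fun t _ y _ => hder y t
    rw [Nat.cast_succ, contDiff_succ_iff_hasFDerivAt]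
    exact ⟨_, ih F' hF', key⟩

theorem SmoothMap.hadamard {n : ℕ} (h : SmoothMap n) : ∃ k : Fin n → SmoothMap (n + n),
    h.comp (fun i => proj (Fin.castAdd n i)) - h.comp (fun i => proj (Fin.natAdd n i)) =
      ∑ i, (proj (Fin.castAdd n i) - proj (Fin.natAdd n i)) * k i := by
  let p : (Fin (n + n) → ℝ) → (Fin n → ℝ) := fun z i => z (Fin.castAdd n i)
  let q : (Fin (n + n) → ℝ) → (Fin n → ℝ) := fun z i => z (Fin.natAdd n i)
  have hp : ContDiff ℝ ∞ p := contDiff_pi.2 fun i => contDiff_apply ℝ ℝ _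
  have hq : ContDiff ℝ ∞ q := contDiff_pi.2 fun i => contDiff_apply ℝ ℝ _
  let F : (Fin (n + n) → ℝ) → ℝ → ((Fin n → ℝ) →L[ℝ] ℝ) :=
    fun z t => fderiv ℝ h (q z + t • (p z - q z))
  have hF : ContDiff ℝ ∞ (fun w : (Fin (n + n) → ℝ) × ℝ => F w.1 w.2) := by
    refine (h.2.fderiv_right (m := ∞) (by simp)).comp ?_
    exact (hq.comp contDiff_fst).add
      (contDiff_snd.smul ((hp.comp contDiff_fst).sub (hq.comp contDiff_fst)))
  let K : (Fin (n + n) → ℝ) → ((Fin n → ℝ) →L[ℝ] ℝ) := fun z => ∫ t in (0 : ℝ)..1, F z t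
  have hK : ContDiff ℝ ∞ K :=
    contDiff_infty.2 fun m => contDiff_parametric_integral m F (contDiff_infty.1 hF m)
  have hFc : ∀ z, Continuous (F z) :=
    fun z => hF.continuous.comp (by fun_prop : Continuous fun t => (z, t))
  have hmain : ∀ z, h (p z) - h (q z) = K z (p z - q z) := by
    intro z
    have hd : ∀ t : ℝ, HasDerivAt (fun t : ℝ => h (q z + t • (p z - q z)))
        (F z t (p z - q z)) t := by
      intro t
      have h1 : HasFDerivAt h (F z t) (q z + t • (p z - q z)) :=
        (h.2.differentiable (by simp) _).hasFDerivAt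
      have h2 : HasDerivAt (fun t : ℝ => q z + t • (p z - q z)) (p z - q z) t := by
        simpa using ((hasDerivAt_id t).smul_const (p z - q z)).const_add (q z)
      exact h1.comp_hasDerivAt t h2
    have hint := intervalIntegral.integral_eq_sub_of_hasDerivAt (a := 0) (b := 1)
      (fun t _ => hd t) (((hFc z).clm_apply continuous_const).intervalIntegrable 0 1)
    rw [ContinuousLinearMap.intervalIntegral_apply ((hFc z).intervalIntegrable 0 1), hint]
    simp
  let k : Fin n → SmoothMap (n + n) :=
    fun i => ⟨fun z => K z (Pi.single i 1), hK.clm_apply contDiff_const⟩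
  refine ⟨k, ?_⟩
  ext z
  have hsum : ∀ (s : Finset (Fin n)) (f : Fin n → SmoothMap (n + n)),
      (∑ i ∈ s, f i : SmoothMap (n + n)) z = ∑ i ∈ s, f i z := by
    intro s f
    classical
    induction s using Finset.induction_on with
    | empty => simp
    | insert a s ha ih => rw [Finset.sum_insert ha, Finset.sum_insert ha, add_apply, ih]
  rw [hsum, sub_apply]
  refine (hmain z).trans ?_
  conv_lhs => rw [← (LinearMap.sum_single_apply (φ := fun _ => ℝ) (p z - q z))]
  rw [map_sum]
  refine Finset.sum_congr rfl fun i _ => ?_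
  have hk : ((proj (Fin.castAdd n i) - proj (Fin.natAdd n i)) * k i : SmoothMap (n + n)) z =
      (p z - q z) i * K z (Pi.single i 1) := by
    rw [mul_apply, sub_apply]; rfl
  rw [hk]
  have : (Pi.single i ((p z - q z) i) : Fin n → ℝ) = ((p z - q z) i) • Pi.single i 1 := by
    rw [← Pi.single_smul]; simp
  simp only [this, map_smul, smul_eq_mul]

theorem CInftyRing.op_sub_op_mem {A : Type u} [CInftyRing A] (I : Ideal A) {n : ℕ}
    (h : SmoothMap n) (a b : Fin n → A) (hab : ∀ i, a i - b i ∈ I) : op h a - op h b ∈ I := by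
  obtain ⟨k, hk⟩ := h.hadamard
  have := congrArg (SmoothMap.evalHom (Fin.append a b)).toRingHom hk
  rw [map_sub, map_sum] at this
  have e1 : (SmoothMap.evalHom (Fin.append a b)).toRingHom
      (h.comp fun i => SmoothMap.proj (Fin.castAdd n i)) = op h a := by
    change op _ _ = _
    rw [op_comp]; congr 1; funext i; rw [op_proj, Fin.append_left]
  have e2 : (SmoothMap.evalHom (Fin.append a b)).toRingHom
      (h.comp fun i => SmoothMap.proj (Fin.natAdd n i)) = op h b := by
    change op _ _ = _
    rw [op_comp]; congr 1; funext i; rw [op_proj, Fin.append_right]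
  rw [e1, e2] at this
  rw [this]
  refine I.sum_mem fun i _ => ?_
  rw [map_mul, map_sub]
  refine I.mul_mem_right _ ?_
  have e3 : (SmoothMap.evalHom (Fin.append a b)).toRingHom (SmoothMap.proj (Fin.castAdd n i)) =
      a i := by
    change op _ _ = _
    rw [op_proj, Fin.append_left]
  have e4 : (SmoothMap.evalHom (Fin.append a b)).toRingHom (SmoothMap.proj (Fin.natAdd n i)) =
      b i := by
    change op _ _ = _
    rw [op_proj, Fin.append_right]
  rw [e3, e4]
  exact hab i

section Quotient

variable {A : Type u} [CInftyRing A] (I : Ideal A)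

/-- The interpretation of a smooth function in `A ⧸ I`, computed on representatives. -/
noncomputable def quotientOp {n : ℕ} (h : SmoothMap n) (a : Fin n → A ⧸ I) : A ⧸ I :=
  Ideal.Quotient.mk I (CInftyRing.op h (fun i => (a i).out))

/-- The interpretation of a smooth function in `A ⧸ I` does not depend on the representatives. -/
theorem quotientOp_mk {n : ℕ} (h : SmoothMap n) (a : Fin n → A) :
    quotientOp I h (fun i => Ideal.Quotient.mk I (a i)) =
      Ideal.Quotient.mk I (CInftyRing.op h a) := by
  refine Ideal.Quotient.eq.2 (CInftyRing.op_sub_op_mem I h _ _ fun i => ?_)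
  exact Ideal.Quotient.eq.1 (Quotient.out_eq (Ideal.Quotient.mk I (a i)))

theorem exists_eq_mk {n : ℕ} (a : Fin n → A ⧸ I) :
    ∃ b : Fin n → A, a = fun i => Ideal.Quotient.mk I (b i) :=
  ⟨fun i => (a i).out, funext fun i => (Quotient.out_eq (a i)).symm⟩

/-- The quotient `A ⧸ I`, with its usual ring structure, as a `C^∞`-ring. -/
noncomputable instance instCInftyRingQuotient : CInftyRing (A ⧸ I) where
  toCommRing := Ideal.Quotient.commRing I
  op := quotientOp I
  op_proj i a := by
    obtain ⟨b, rfl⟩ := exists_eq_mk I a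
    rw [quotientOp_mk, CInftyRing.op_proj]
  op_comp h g a := by
    obtain ⟨b, rfl⟩ := exists_eq_mk I a
    simp only [quotientOp_mk, CInftyRing.op_comp]
  op_add a b := by
    obtain ⟨a, rfl⟩ := Ideal.Quotient.mk_surjective a
    obtain ⟨b, rfl⟩ := Ideal.Quotient.mk_surjective b
    rw [← map_add, ← CInftyRing.op_add, ← quotientOp_mk]
    congr 1; funext i; fin_cases i <;> rfl
  op_mul a b := by
    obtain ⟨a, rfl⟩ := Ideal.Quotient.mk_surjective a
    obtain ⟨b, rfl⟩ := Ideal.Quotient.mk_surjective b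
    rw [← map_mul, ← CInftyRing.op_mul, ← quotientOp_mk]
    congr 1; funext i; fin_cases i <;> rfl

/-- The quotient map `q_I : A → A ⧸ I`. -/
noncomputable def quotientHom : CInftyHom A (A ⧸ I) where
  toFun := Ideal.Quotient.mk I
  map_op h a := (quotientOp_mk I h a).symm

end Quotient

/-! ### `C^∞`-rings of fractions -/

/-- The universal property of the `C^∞`-ring of fractions of `A` with respect to `S`, against
`C^∞`-rings in the universe `w`. -/
structure IsRingOfFractions {A : Type u} [CInftyRing A] (S : Set A) {L : Type v} [CInftyRing L]
    (η : CInftyHom A L) : Prop where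
  isUnit : ∀ s ∈ S, IsUnit (η s)
  existsUnique : ∀ {B : Type w} [CInftyRing B] (φ : CInftyHom A B), (∀ s ∈ S, IsUnit (φ s)) →
    ∃! ψ : CInftyHom L B, ∀ a, ψ (η a) = φ a

section Fractions

variable {A : Type u} [CInftyRing A] (S : Set A)

/-- Formal expressions in the elements of `A`, formal inverses of the elements of `S`, and the
smooth operations. -/
inductive FractionTerm : Type u
  | of : A → FractionTerm
  | inv : S → FractionTerm
  | op : {n : ℕ} → SmoothMap n → (Fin n → FractionTerm) → FractionTerm

/-- The congruence on formal expressions generated by the laws of `C^∞`-rings, by the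
interpretations of the operations in `A`, and by `s * s⁻¹ = 1` for `s ∈ S`. -/
inductive FractionTerm.Rel : FractionTerm S → FractionTerm S → Prop
  | refl (x) : Rel x x
  | symm {x y} : Rel x y → Rel y x
  | trans {x y z} : Rel x y → Rel y z → Rel x z
  | congr {n : ℕ} (h : SmoothMap n) (x y : Fin n → FractionTerm S) :
      (∀ i, Rel (x i) (y i)) → Rel (.op h x) (.op h y)
  | proj {n : ℕ} (i : Fin n) (x : Fin n → FractionTerm S) : Rel (.op (SmoothMap.proj i) x) (x i)
  | comp {m n : ℕ} (h : SmoothMap n) (g : Fin n → SmoothMap m) (x : Fin m → FractionTerm S) :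
      Rel (.op (h.comp g) x) (.op h (fun i => .op (g i) x))
  | of_op {n : ℕ} (h : SmoothMap n) (a : Fin n → A) :
      Rel (.of (CInftyRing.op h a)) (.op h (fun i => .of (a i)))
  | mul_inv (s : S) : Rel (.op SmoothMap.mul ![.of s, .inv s]) (.of 1)

/-- The setoid of the congruence `FractionTerm.Rel`. -/
def FractionTerm.setoid : Setoid (FractionTerm S) :=
  ⟨FractionTerm.Rel S, ⟨.refl, .symm, .trans⟩⟩

/-- The `C^∞`-ring of fractions `A{S⁻¹}`. -/
def RingOfFractions : Type u := Quotient (FractionTerm.setoid S)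

namespace RingOfFractions

/-- The class of a formal expression. -/
def mk (x : FractionTerm S) : RingOfFractions S := Quotient.mk (FractionTerm.setoid S) x

theorem sound {x y : FractionTerm S} (h : FractionTerm.Rel S x y) : mk S x = mk S y :=
  Quotient.sound (s := FractionTerm.setoid S) h

/-- The smooth operations on `A{S⁻¹}`, computed on representatives. -/
noncomputable def opFun {n : ℕ} (h : SmoothMap n) (x : Fin n → RingOfFractions S) :
    RingOfFractions S :=
  mk S (.op h (fun i => Quotient.out (x i)))

theorem opFun_mk {n : ℕ} (h : SmoothMap n) (x : Fin n → FractionTerm S) :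
    opFun S h (fun i => mk S (x i)) = mk S (.op h x) :=
  sound S (.congr h _ _ fun i =>
    Quotient.exact (s := FractionTerm.setoid S) (Quotient.out_eq (mk S (x i))))

theorem exists_eq_mk {n : ℕ} (x : Fin n → RingOfFractions S) :
    ∃ y : Fin n → FractionTerm S, x = fun i => mk S (y i) :=
  ⟨fun i => Quotient.out (x i), funext fun i => (Quotient.out_eq (x i)).symm⟩

noncomputable instance instCInftyRing : CInftyRing (RingOfFractions S) :=
  CInftyRing.ofOps (opFun S)
    (fun i x => by
      obtain ⟨y, rfl⟩ := exists_eq_mk S x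
      rw [opFun_mk]; exact sound S (.proj i y))
    (fun h g x => by
      obtain ⟨y, rfl⟩ := exists_eq_mk S x
      simp only [opFun_mk]; exact sound S (.comp h g y))

theorem op_mk {n : ℕ} (h : SmoothMap n) (x : Fin n → FractionTerm S) :
    CInftyRing.op h (fun i => mk S (x i)) = mk S (.op h x) := opFun_mk S h x

/-- The canonical homomorphism `η_S : A → A{S⁻¹}`. -/
noncomputable def η : CInftyHom A (RingOfFractions S) where
  toFun a := mk S (.of a)
  map_op h a := by rw [op_mk]; exact sound S (.of_op h a)

theorem η_mul_inv (s : S) : η S s * mk S (.inv s) = 1 := by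
  have h1 : η S (1 : A) = 1 := (η S).toRingHom.map_one
  rw [← h1, ← CInftyRing.op_mul]
  refine Eq.trans ?_ (sound S (.mul_inv s))
  rw [← op_mk]
  congr 1; funext i; fin_cases i <;> rfl

/-- The value of a formal expression under a homomorphism that inverts the elements of `S`. -/
noncomputable def eval {B : Type v} [CInftyRing B] (φ : CInftyHom A B) : FractionTerm S → B
  | .of a => φ a
  | .inv s => Ring.inverse (φ s)
  | .op h x => CInftyRing.op h (fun i => eval φ (x i))

theorem eval_eq {B : Type v} [CInftyRing B] (φ : CInftyHom A B) (hφ : ∀ s ∈ S, IsUnit (φ s))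
    {x y : FractionTerm S} (h : FractionTerm.Rel S x y) : eval S φ x = eval S φ y := by
  induction h with
  | refl => rfl
  | symm _ ih => exact ih.symm
  | trans _ _ ih1 ih2 => exact ih1.trans ih2
  | congr h x y _ ih => simp only [eval, ih]
  | proj i x => simp only [eval, CInftyRing.op_proj]
  | comp h g x => simp only [eval, CInftyRing.op_comp]
  | of_op h a => simp only [eval, φ.map_op]
  | mul_inv s =>
    have h1 : φ (1 : A) = 1 := φ.toRingHom.map_one
    simp only [eval, h1]
    rw [← Ring.mul_inverse_cancel _ (hφ s s.2), ← CInftyRing.op_mul]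
    congr 1; funext i; fin_cases i <;> rfl

/-- `A{S⁻¹}` has the universal property of the `C^∞`-ring of fractions. -/
theorem isRingOfFractions : IsRingOfFractions.{u, u, w} S (η S) where
  isUnit s hs := IsUnit.of_mul_eq_one _ (η_mul_inv S ⟨s, hs⟩)
  existsUnique {B} _ φ hφ := by
    refine ⟨⟨Quotient.lift (s := FractionTerm.setoid S) (eval S φ)
      (fun _ _ h => eval_eq S φ hφ h), fun h x => ?_⟩, fun a => rfl, fun ψ hψ => ?_⟩
    · obtain ⟨y, rfl⟩ := exists_eq_mk S x
      rw [op_mk]; rfl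
    · have key : ∀ x : FractionTerm S, ψ (mk S x) = eval S φ x := by
        intro x
        induction x with
        | of a => exact hψ a
        | inv s =>
          have h1 : ψ (η S s) * ψ (mk S (.inv s)) = 1 := by
            rw [← ψ.map_mul, η_mul_inv]; exact ψ.toRingHom.map_one
          rw [hψ] at h1
          have h2 := Ring.inverse_mul_cancel _ (hφ s s.2)
          calc ψ (mk S (.inv s)) = Ring.inverse (φ s) * φ s * ψ (mk S (.inv s)) := by
                rw [h2, one_mul]
            _ = Ring.inverse (φ s) := by rw [mul_assoc, h1, mul_one]
        | op h x ih =>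
          rw [← op_mk, ψ.map_op]
          simp only [ih, eval]
      obtain ⟨ψ, hψ'⟩ := ψ
      congr 1
      funext x
      induction x using Quotient.inductionOn with
      | h x => exact key x

end RingOfFractions

end Fractions

/-! ### `C^∞`-radical ideals -/

/-- The `C^∞`-radical of an ideal `I`: the set of those `a ∈ A` for which `(A/I){(a+I)⁻¹}` is
the zero ring. -/
def cinftyRadical {A : Type u} [CInftyRing A] (I : Ideal A) : Set A :=
  {a | Subsingleton (RingOfFractions ({Ideal.Quotient.mk I a} : Set (A ⧸ I)))}

/-- An ideal is `C^∞`-radical if it is equal to its `C^∞`-radical. -/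
def IsCInftyRadical {A : Type u} [CInftyRing A] (I : Ideal A) : Prop :=
  cinftyRadical I = (I : Set A)

end SmoothAlgebra

open SmoothAlgebra

/-! If `f - g` lies in `I`, it serves as `φ` itself. The content is the converse: if `φ ∈ I` and `h
= f - g` vanishes on `Z(φ)`, then `h ∈ I`. Since `I` is `C^∞`-radical, it suffices that inverting
`h` in `A/I` gives the zero ring.

This is a Rabinowitsch argument. Suppose that in a `C^∞`-ring `B` the value of `φ` at a tuple `b` is
zero and that of `h` has an inverse `t`. On `ℝⁿ⁺¹`, with an extra variable `T`, the function `φ² +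
(hT - 1)²` has no zero, because `φ = 0` forces `h = 0`. Its reciprocal is therefore smooth and it is
a unit; yet at `(t, b)` it takes the value `0`. So `0` is a unit of `B`, and `B` is trivial. This is
`CInftyRing.subsingleton_of_zeroSet_subset`, which `IsCInftyRadical.op_mem_of_zeroSet_subset`
applies to the ring of fractions.

For arbitrary `E`, the functions `φ` and `h` depend on finitely many common coordinates. The
projection of `ℝ^E` to these is surjective, so the inclusion of zero sets descends to some `ℝⁿ`. -/

namespace SmoothAlgebra

/-! ### Rabinowitsch's trick for smooth functions -/

/-- A nowhere vanishing smooth function is invertible in `C^∞(ℝⁿ)`. -/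
theorem SmoothMap.isUnit_of_forall_ne_zero {n : ℕ} (F : SmoothMap n) (hF : ∀ x, F x ≠ 0) :
    IsUnit F := by
  let G : SmoothMap n := ⟨fun x => (F x)⁻¹, F.2.inv hF⟩
  exact IsUnit.of_mul_eq_one G (SmoothMap.ext fun x => mul_inv_cancel₀ (hF x))

/-- If `h` vanishes on the zero set of `φ`, then a `C^∞`-ring containing a common point at which
`φ` is zero and `h` is invertible is the zero ring. -/
theorem CInftyRing.subsingleton_of_zeroSet_subset {B : Type u} [CInftyRing B] {n : ℕ}
    (b : Fin n → B) (φ h : SmoothMap n) (hφh : φ.zeroSet ⊆ h.zeroSet)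
    (hφ : CInftyRing.op φ b = 0) (hh : IsUnit (CInftyRing.op h b)) : Subsingleton B := by
  obtain ⟨t, ht⟩ := hh.exists_right_inv
  -- Variable `0` stands for the inverse of `h(b)`; the variables `i.succ` stand for the entries of
  -- `b`.
  let c : Fin (n + 1) → B := Fin.cons t b
  let φ' : SmoothMap (n + 1) := φ.comp fun i => SmoothMap.proj i.succ
  let h' : SmoothMap (n + 1) := h.comp fun i => SmoothMap.proj i.succ
  let T : SmoothMap (n + 1) := SmoothMap.proj 0
  let F : SmoothMap (n + 1) := φ' * φ' + (h' * T - 1) * (h' * T - 1)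
  have hF : IsUnit F := by
    refine F.isUnit_of_forall_ne_zero fun x hx => ?_
    simp only [F, SmoothMap.add_apply, SmoothMap.mul_apply, SmoothMap.sub_apply,
      SmoothMap.one_apply] at hx
    -- Over `ℝ` both squares vanish. Then `φ = 0` gives `h = 0`, and `hT - 1 = 0` becomes `-1 = 0`.
    obtain ⟨h1, h2⟩ := mul_self_add_mul_self_eq_zero.1 hx
    have h3 : h' x = 0 := hφh (a := fun i => x i.succ) h1
    simp [h3] at h2
  let ev := (SmoothMap.evalHom c).toRingHom
  have ev_comp (k : SmoothMap n) :
      ev (k.comp fun i => SmoothMap.proj i.succ) = CInftyRing.op k b := by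
    change CInftyRing.op (k.comp _) c = _
    simp only [CInftyRing.op_comp, CInftyRing.op_proj, c, Fin.cons_succ]
  have evT : ev T = t := CInftyRing.op_proj 0 c
  have evF : ev F = 0 := by
    simp only [F, φ', h', map_add, map_mul, map_sub, map_one, ev_comp, evT, hφ, ht, sub_self,
      mul_zero, add_zero]
  -- Evaluation at `c` is a ring homomorphism, so it sends the unit `F` to a unit, which is also
  -- `0`.
  exact subsingleton_of_zero_eq_one (isUnit_zero_iff.1 (evF ▸ hF.map ev))

/-! ### Zero sets and `C^∞`-radical ideals -/

/-- A `C^∞`-radical ideal containing `φ(a)` contains `h(a)` for each smooth `h` that vanishes on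
the zero set of `φ`. -/
theorem IsCInftyRadical.op_mem_of_zeroSet_subset {A : Type u} [CInftyRing A] {I : Ideal A}
    (hI : IsCInftyRadical I) {n : ℕ} (a : Fin n → A) (φ h : SmoothMap n)
    (hφh : φ.zeroSet ⊆ h.zeroSet) (hφ : CInftyRing.op φ a ∈ I) : CInftyRing.op h a ∈ I := by
  -- Membership in the radical unfolds to triviality of the ring of fractions, which is what the
  -- previous lemma yields.
  rw [← SetLike.mem_coe, ← hI]
  let S : Set (A ⧸ I) := {Ideal.Quotient.mk I (CInftyRing.op h a)}
  let η := RingOfFractions.η S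
  -- The composite `A → A/I → (A/I){S⁻¹}` commutes with smooth operations: it sends `φ(a)` to `0`
  -- and `h(a)` to a unit.
  have map_op (k : SmoothMap n) : CInftyRing.op k (fun i => η (quotientHom I (a i))) =
      η (Ideal.Quotient.mk I (CInftyRing.op k a)) := by
    rw [← η.map_op, ← (quotientHom I).map_op]
    rfl
  refine CInftyRing.subsingleton_of_zeroSet_subset
    (fun i => η (quotientHom I (a i))) φ h hφh ?_ ?_
  · rw [map_op, Ideal.Quotient.eq_zero_iff_mem.2 hφ]
    exact η.toRingHom.map_zero
  · rw [map_op]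
    exact (RingOfFractions.isRingOfFractions.{u, u} S).isUnit _ rfl

/-- The coordinate functions form the generic point of `C^∞(ℝⁿ)`, so results about values at tuples
apply to its elements themselves. -/
theorem SmoothMap.op_proj_eq_self {n : ℕ} (f : SmoothMap n) :
    CInftyRing.op f (fun i => (SmoothMap.proj i : SmoothMap n)) = f := rfl

/-! ### Reduction to finitely many coordinates -/

/-- Two smooth functions on `ℝ^E` are smooth functions of finitely many coordinates. -/
theorem SmoothFun.exists_eq_op_coordinates {E : Type u} (f g : SmoothFun E) :
    ∃ (n : ℕ) (a : Fin n → SmoothFun E) (f' g' : SmoothMap n),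
      f = CInftyRing.op f' a ∧ g = CInftyRing.op g' a ∧
        ∀ y : Fin n → ℝ, ∃ x : E → ℝ, ∀ i, a i x = y i := by
  classical
  obtain ⟨f, E₁, f', hf', rfl⟩ := f
  obtain ⟨g, E₂, g', hg', rfl⟩ := g
  -- Enumerating the union lets both functions be expressed in the same coordinates.
  let σ := (E₁ ∪ E₂).equivFin
  have h₁ : ∀ e ∈ E₁, e ∈ E₁ ∪ E₂ := fun e he => Finset.mem_union_left _ he
  have h₂ : ∀ e ∈ E₂, e ∈ E₁ ∪ E₂ := fun e he => Finset.mem_union_right _ he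
  refine ⟨(E₁ ∪ E₂).card,
    fun i => ⟨fun x => x (σ.symm i), {(σ.symm i : E)}, fun y => y ⟨_, Finset.mem_singleton_self _⟩,
      contDiff_apply ℝ ℝ _, rfl⟩,
    ⟨fun y => f' fun e => y (σ ⟨e, h₁ e e.2⟩),
      hf'.comp (contDiff_pi.2 fun e => contDiff_apply ℝ ℝ _)⟩,
    ⟨fun y => g' fun e => y (σ ⟨e, h₂ e e.2⟩),
      hg'.comp (contDiff_pi.2 fun e => contDiff_apply ℝ ℝ _)⟩, ?_, ?_, fun y => ?_⟩
  · ext x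
    change f' (fun e => x e) = f' (fun e => x (σ.symm (σ ⟨e, h₁ e e.2⟩)))
    simp only [Equiv.symm_apply_apply]
  · ext x
    change g' (fun e => x e) = g' (fun e => x (σ.symm (σ ⟨e, h₂ e e.2⟩)))
    simp only [Equiv.symm_apply_apply]
  -- Any values may be prescribed on the finite set of coordinates; the extension by `0` elsewhere
  -- is arbitrary.
  · exact ⟨fun e => if he : e ∈ E₁ ∪ E₂ then y (σ ⟨e, he⟩) else 0, fun i => by simp⟩

end SmoothAlgebra

open SmoothAlgebra
theorem proposition2p7 :
    (∀ (E : Type u) (I : Ideal (SmoothFun E)), IsCInftyRadical I → ∀ f g : SmoothFun E,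
      (Ideal.Quotient.mk I f = Ideal.Quotient.mk I g ↔
        ∃ φ ∈ I, ∀ x ∈ φ.zeroSet, f x = g x)) ∧
    (∀ (n : ℕ) (I : Ideal (SmoothMap n)), IsCInftyRadical I → ∀ f g : SmoothMap n,
      (Ideal.Quotient.mk I f = Ideal.Quotient.mk I g ↔
        ∃ φ ∈ I, ∀ x ∈ φ.zeroSet, f x = g x)) := by
  constructor
  · intro E I hI f g
    rw [Ideal.Quotient.eq]
    refine ⟨fun h => ⟨f - g, h, fun x hx => sub_eq_zero.1 ?_⟩, ?_⟩
    · exact (SmoothFun.sub_apply f g x).symm.trans hx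
    · rintro ⟨φ, hφ, hfg⟩
      obtain ⟨n, a, φ', k, hφ', hk, ha⟩ := SmoothFun.exists_eq_op_coordinates φ (f - g)
      rw [hk]
      -- A zero `y` of `φ'` in `ℝⁿ` lifts to a point `x` of `ℝ^E`. There `φ x = 0`, so the
      -- hypothesis on `f` and `g` applies.
      refine hI.op_mem_of_zeroSet_subset a φ' k (fun y hy => ?_) (hφ' ▸ hφ)
      obtain ⟨x, hx⟩ := ha y
      obtain rfl : (fun i => a i x) = y := funext hx
      have hφx : φ x = 0 := by rw [hφ']; exact hy
      change (CInftyRing.op k a : SmoothFun E) x = 0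
      rw [← hk, SmoothFun.sub_apply, hfg x hφx, sub_self]
  · intro n I hI f g
    rw [Ideal.Quotient.eq]
    refine ⟨fun h => ⟨f - g, h, fun x hx => sub_eq_zero.1 ?_⟩, ?_⟩
    · exact (SmoothMap.sub_apply f g x).symm.trans hx
    · rintro ⟨φ, hφ, hfg⟩
      rw [← SmoothMap.op_proj_eq_self (f - g)]
      -- No lifting is needed here: the tuple consists of all coordinate functions, and `φ` is by
      -- definition its own value at them.
      refine hI.op_mem_of_zeroSet_subset _ φ _ (fun x hx => ?_) hφ
      change (f - g) x = 0
      rw [SmoothMap.sub_apply, hfg x hx, sub_self]
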